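/- Let $\Phi$ be the standard normal distribution function and $z_p$ its $p$-quantile, and put $$\mathrm{CP}(t,z)=\Phi(z\sec t-\tan t)-\Phi(-z\sec t-\tan t).$$ Let $\theta,b_2\in\mathbb R$ and $0<s_2<s_1$ with $b_2^2+s_2^2\le s_1^2$, and let $\hat\theta_1\sim N(\theta,s_1^2)$ and $\hat\theta_2\sim N(\theta+b_2,s_2^2)$ be random variables. For $0<\alpha<1$ let $\mathrm{CI}_2$ be the interval $\hat\theta_2\pm z_{1-\alpha/2}s_1$, and let $\mathrm{CI}_5$ be the interval $\hat\theta_2\pm\tilde z_{1-\alpha/2}s_1$, where $\tilde z_{1-\alpha/2}$ is the solution of $1-\alpha=\mathrm{CP}(\arccos(s_2/s_1),\tilde z_{1-\alpha/2})$. Then: 1. For every $0<\alpha<1$ the number $\tilde z_{1-\alpha/2}$ exists and is unique. 2. If $0.917<1-\alpha<1$, then $\tilde z_{1-\alpha/2}<z_{1-\alpha/2}$, and $\mathrm{CI}_5$ is strictly shorter than $\mathrm{CI}_2$. 3. If $1-\alpha=0.9$, then the length of $\mathrm{CI}_5$ is at most $1.00014$ times the length of $\mathrm{CI}_2$ (that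 is, $\mathrm{CI}_5$ is at most $0.014\%$ longer). 4. If $1-\alpha=0.9$, then $\mathrm{CI}_5$ can be significantly shorter than $\mathrm{CI}_2$: there is $\delta\in(0,1)$ such that, whenever $0<s_2\le\delta s_1$, the length of $\mathrm{CI}_5$ is less than $61\%$ of the length of $\mathrm{CI}_2$. -/

import Mathlib

open MeasureTheory ProbabilityTheory Set

noncomputable section

/-- The standard normal cumulative distribution function `Φ`. -/
def stdNormalCDF (x : ℝ) : ℝ := cdf (gaussianReal 0 1) x

/-- The `p`-quantile `z_p` of the standard normal distribution (meaningful for `0 < p < 1`). -/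
def stdNormalQuantile (p : ℝ) : ℝ := sInf {x : ℝ | p ≤ stdNormalCDF x}

/-- `CP(t, z) = Φ(z sec t - tan t) - Φ(-z sec t - tan t)`: the probability that `θ` lies in
`θhat₂ ± z s₁` when `θhat₂` has bias `s₁ sin t` and standard deviation `s₁ cos t`. -/
def coverageProb (t z : ℝ) : ℝ :=
  stdNormalCDF (z * (Real.cos t)⁻¹ - Real.tan t) -
    stdNormalCDF (-z * (Real.cos t)⁻¹ - Real.tan t)

/-- The interval `center ± c * s`. -/
def symmInterval (center c s : ℝ) : Set ℝ := Icc (center - c * s) (center + c * s)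

/-- The length of a set of reals, as its Lebesgue measure. -/
def intervalLength (I : Set ℝ) : ℝ := volume.real I

/-- `CI₂ = θhat₂ ± z_{1-α/2} s₁`, at the realized value `x` of `θhat₂`. -/
def CI₂ (s₁ α x : ℝ) : Set ℝ := symmInterval x (stdNormalQuantile (1 - α / 2)) s₁

/-- `c` solves the equation `1 - α = CP(arccos (s₂ / s₁), c)`, which defines the critical value
of `CI₅` implicitly. -/
def IsCalibrated (s₁ s₂ α c : ℝ) : Prop :=
  1 - α = coverageProb (Real.arccos (s₂ / s₁)) c

/-- `CI₅ = θhat₂ ± c s₁`, at the realized value `x` of `θhat₂`, where `c` is the calibrated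
critical value (see `IsCalibrated`). -/
def CI₅ (s₁ c x : ℝ) : Set ℝ := symmInterval x c s₁

end

/-!
With `u = z sin t`, the derivative of `t ↦ CP(t, z)` has the sign of
`artanh u - sec² t * u` where `u < 1`, and is positive where `u ≥ 1`. Since
`artanh u > u / (1 - u² / 3)`, it is positive for all `t` as soon as `z² ≥ 3`, and then
`CP(t, z) > CP(0, z)`; the bound 0.917 is a value slightly above `2 Φ(√3) - 1`.
For the smaller `z` of the level 90%, `CP(t, z)` first decreases and then increases. Integrating a
polynomial bound for its derivative over the decreasing part shows that the loss is below `0.00005`,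
which raising `z` by 0.014% makes up for. Finally, the relative bias `sin t` is at most `1`, so
`CI₅` needs at most the critical value `1 + z_{1-α/2} s₂ / s₁`.
-/

noncomputable section

open Filter Topology Real

local notation "φ" => gaussianPDFReal 0 1

lemma le_of_hasDerivAt_nonneg {f f' : ℝ → ℝ} {a b : ℝ} (hab : a ≤ b)
    (hd : ∀ x ∈ Icc a b, HasDerivAt f (f' x) x) (hf' : ∀ x ∈ Icc a b, 0 ≤ f' x) : f a ≤ f b :=
  monotoneOn_of_hasDerivWithinAt_nonneg (convex_Icc a b)
    (fun x hx => (hd x hx).continuousAt.continuousWithinAt)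
    (fun x hx => (hd x (interior_subset hx)).hasDerivWithinAt)
    (fun x hx => hf' x (interior_subset hx)) (left_mem_Icc.2 hab) (right_mem_Icc.2 hab) hab

/-! ### The standard normal distribution function -/

lemma gaussianPDFReal_zero_one (x : ℝ) : φ x = (√(2 * π))⁻¹ * exp (-(x ^ 2 / 2)) := by
  simp [gaussianPDFReal_def, neg_div]

lemma gaussianPDFReal_zero_one_pos (x : ℝ) : 0 < φ x :=
  gaussianPDFReal_pos 0 1 x one_ne_zero

lemma continuous_gaussianPDFReal_zero_one : Continuous φ := by
  simp_rw [funext gaussianPDFReal_zero_one]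
  fun_prop

lemma stdNormalCDF_eq_integral (x : ℝ) : stdNormalCDF x = ∫ y in Iic x, φ y := by
  rw [stdNormalCDF, cdf_eq_real, measureReal_def,
    gaussianReal_apply_eq_integral 0 one_ne_zero, ENNReal.toReal_ofReal]
  exact integral_nonneg fun y => gaussianPDFReal_nonneg 0 1 y

lemma hasDerivAt_stdNormalCDF (x : ℝ) : HasDerivAt stdNormalCDF (φ x) x := by
  have hint (s : Set ℝ) : IntegrableOn φ s := (integrable_gaussianPDFReal 0 1).integrableOn
  have h : stdNormalCDF = fun x => stdNormalCDF 0 + ∫ y in (0 : ℝ)..x, φ y := by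
    funext x
    rw [stdNormalCDF_eq_integral, stdNormalCDF_eq_integral,
      ← intervalIntegral.integral_Iic_sub_Iic (hint _) (hint _), add_sub_cancel]
  rw [h]
  exact (continuous_gaussianPDFReal_zero_one.integral_hasStrictDerivAt 0 x).hasDerivAt.const_add _

lemma continuous_stdNormalCDF : Continuous stdNormalCDF :=
  continuous_iff_continuousAt.2 fun x => (hasDerivAt_stdNormalCDF x).continuousAt

lemma strictMono_stdNormalCDF : StrictMono stdNormalCDF :=
  strictMono_of_hasDerivAt_pos hasDerivAt_stdNormalCDF gaussianPDFReal_zero_one_pos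

lemma stdNormalCDF_neg (x : ℝ) : stdNormalCDF (-x) = 1 - stdNormalCDF x := by
  have hneg : (gaussianReal 0 1).map (fun y => -y) = gaussianReal 0 1 := by
    simp [gaussianReal_map_neg]
  have := nullSingletonClass_gaussianReal (μ := 0) one_ne_zero
  calc stdNormalCDF (-x) = ((gaussianReal 0 1).map fun y => -y).real (Iic (-x)) := by
        rw [stdNormalCDF, cdf_eq_real, hneg]
    _ = (gaussianReal 0 1).real (Ici x) := by
        rw [map_measureReal_apply measurable_neg measurableSet_Iic]
        congr 1
        ext y
        simp
    _ = (gaussianReal 0 1).real (Iic x)ᶜ := by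
        rw [compl_Iic, measureReal_congr Ioi_ae_eq_Ici]
    _ = 1 - stdNormalCDF x := by
        rw [probReal_compl_eq_one_sub measurableSet_Iic, stdNormalCDF, cdf_eq_real]

lemma stdNormalCDF_zero : stdNormalCDF 0 = 1 / 2 := by
  have := stdNormalCDF_neg 0
  rw [neg_zero] at this
  linarith

lemma tendsto_stdNormalCDF_atTop : Tendsto stdNormalCDF atTop (𝓝 1) :=
  tendsto_cdf_atTop (gaussianReal 0 1)

lemma tendsto_stdNormalCDF_atBot : Tendsto stdNormalCDF atBot (𝓝 0) :=
  tendsto_cdf_atBot (gaussianReal 0 1)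

lemma exists_stdNormalCDF_eq {p : ℝ} (h0 : 0 < p) (h1 : p < 1) : ∃ x, stdNormalCDF x = p :=
  mem_range_of_exists_le_of_exists_ge continuous_stdNormalCDF
    (tendsto_stdNormalCDF_atBot.eventually_le_const h0).exists
    (tendsto_stdNormalCDF_atTop.eventually_const_le h1).exists

lemma stdNormalCDF_stdNormalQuantile {p : ℝ} (h0 : 0 < p) (h1 : p < 1) :
    stdNormalCDF (stdNormalQuantile p) = p := by
  obtain ⟨x, rfl⟩ := exists_stdNormalCDF_eq h0 h1
  have : {y : ℝ | stdNormalCDF x ≤ stdNormalCDF y} = Ici x := by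
    ext y
    exact strictMono_stdNormalCDF.le_iff_le
  rw [stdNormalQuantile, this, csInf_Ici]

lemma le_stdNormalQuantile_iff {p x : ℝ} (h0 : 0 < p) (h1 : p < 1) :
    x ≤ stdNormalQuantile p ↔ stdNormalCDF x ≤ p := by
  rw [← strictMono_stdNormalCDF.le_iff_le, stdNormalCDF_stdNormalQuantile h0 h1]

/-! ### Alternating Taylor bounds -/

lemma hasDerivAt_sum_neg_pow_div_factorial (n : ℕ) (x : ℝ) :
    HasDerivAt (fun x : ℝ => ∑ k ∈ Finset.range (n + 1), (-x) ^ k / k.factorial)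
      (-∑ k ∈ Finset.range n, (-x) ^ k / k.factorial) x := by
  have hterm (k : ℕ) : HasDerivAt (fun x : ℝ => (-x) ^ (k + 1) / (k + 1).factorial)
      (-((-x) ^ k / k.factorial)) x := by
    refine (((hasDerivAt_neg x).fun_pow (k + 1)).div_const _).congr_deriv ?_
    push_cast [Nat.factorial_succ]
    field_simp
  simp_rw [Finset.sum_range_succ', ← Finset.sum_neg_distrib]
  simpa using (HasDerivAt.fun_sum fun k _ => hterm k).add_const 1

lemma neg_one_pow_mul_exp_neg_sub_sum_nonneg (n : ℕ) {x : ℝ} (hx : 0 ≤ x) :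
    0 ≤ (-1) ^ n * (exp (-x) - ∑ k ∈ Finset.range n, (-x) ^ k / k.factorial) := by
  induction n generalizing x with
  | zero => simpa using (exp_pos (-x)).le
  | succ n ih =>
    have hd (y : ℝ) : HasDerivAt (fun x => (-1) ^ (n + 1) *
        (exp (-x) - ∑ k ∈ Finset.range (n + 1), (-x) ^ k / k.factorial))
        ((-1) ^ n * (exp (-y) - ∑ k ∈ Finset.range n, (-y) ^ k / k.factorial)) y := by
      refine (((hasDerivAt_neg y).exp.sub
        (hasDerivAt_sum_neg_pow_div_factorial n y)).const_mul _).congr_deriv ?_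
      ring
    have hle := le_of_hasDerivAt_nonneg hx (fun y _ => hd y) fun y hy => ih hy.1
    refine le_trans (le_of_eq ?_) hle
    simp [Finset.sum_range_succ']

lemma exp_neg_le_quadratic {x : ℝ} (hx : 0 ≤ x) : exp (-x) ≤ 1 - x + x ^ 2 / 2 := by
  have h := neg_one_pow_mul_exp_neg_sub_sum_nonneg 3 hx
  norm_num [Finset.sum_range_succ, Nat.factorial] at h
  linarith

/-- The Taylor polynomial of degree `2 * n - 1` of `∫ y in 0..x, exp (-(y ^ 2 / 2))`, used to
evaluate the normal distribution function numerically. -/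
def gaussIntegralTaylor (n : ℕ) (x : ℝ) : ℝ :=
  ∑ k ∈ Finset.range n, (-1) ^ k * x ^ (2 * k + 1) / (2 ^ k * k.factorial * (2 * k + 1))

lemma hasDerivAt_gaussIntegralTaylor (n : ℕ) (x : ℝ) :
    HasDerivAt (gaussIntegralTaylor n)
      (∑ k ∈ Finset.range n, (-(x ^ 2 / 2)) ^ k / k.factorial) x := by
  refine HasDerivAt.fun_sum fun k _ => ?_
  refine (((hasDerivAt_pow (2 * k + 1) x).const_mul ((-1 : ℝ) ^ k)).div_const _).congr_deriv ?_
  rw [neg_pow (x ^ 2 / 2), div_pow, ← pow_mul]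
  push_cast
  field_simp

lemma neg_one_pow_mul_stdNormalCDF_sub_nonneg (n : ℕ) {x : ℝ} (hx : 0 ≤ x) :
    0 ≤ (-1) ^ n * (√(2 * π) * (stdNormalCDF x - 1 / 2) - gaussIntegralTaylor n x) := by
  have hd (y : ℝ) : HasDerivAt
      (fun x => (-1) ^ n * (√(2 * π) * (stdNormalCDF x - 1 / 2) - gaussIntegralTaylor n x))
      ((-1) ^ n * (exp (-(y ^ 2 / 2)) -
        ∑ k ∈ Finset.range n, (-(y ^ 2 / 2)) ^ k / k.factorial)) y := by
    refine (((((hasDerivAt_stdNormalCDF y).sub_const _).const_mul _).sub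
      (hasDerivAt_gaussIntegralTaylor n y)).const_mul _).congr_deriv ?_
    rw [gaussianPDFReal_zero_one, mul_inv_cancel_left₀ (by positivity)]
  have hle := le_of_hasDerivAt_nonneg hx (fun y _ => hd y)
    fun y _ => neg_one_pow_mul_exp_neg_sub_sum_nonneg n (by positivity)
  refine le_trans (le_of_eq ?_) hle
  simp [stdNormalCDF_zero, gaussIntegralTaylor]

lemma stdNormalCDF_le_of_odd {n : ℕ} (hn : Odd n) {x : ℝ} (hx : 0 ≤ x) :
    stdNormalCDF x ≤ 1 / 2 + gaussIntegralTaylor n x / √(2 * π) := by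
  have h := neg_one_pow_mul_stdNormalCDF_sub_nonneg n hx
  rw [hn.neg_one_pow] at h
  rw [← sub_le_iff_le_add', le_div_iff₀ (by positivity)]
  linarith

lemma le_stdNormalCDF_of_even {n : ℕ} (hn : Even n) {x : ℝ} (hx : 0 ≤ x) :
    1 / 2 + gaussIntegralTaylor n x / √(2 * π) ≤ stdNormalCDF x := by
  have h := neg_one_pow_mul_stdNormalCDF_sub_nonneg n hx
  rw [hn.neg_one_pow] at h
  rw [← le_sub_iff_add_le', div_le_iff₀ (by positivity)]
  linarith

lemma sqrt_two_pi_mem_Ioo : √(2 * π) ∈ Ioo 2.5066282746 2.5066282747 := by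
  have h1 := pi_gt_d20
  have h2 := pi_lt_d20
  constructor
  · apply lt_sqrt_of_sq_lt
    norm_num
    linarith
  · rw [sqrt_lt' (by norm_num)]
    norm_num
    linarith

lemma stdNormalCDF_sqrt_three_lt : stdNormalCDF √3 < 0.9585 := by
  have hsqrt : √3 < 1.7321 := by rw [sqrt_lt' (by norm_num)]; norm_num
  have htaylor : gaussIntegralTaylor 11 1.7321 ≤ 0.4585 * 2.5066282746 := by
    norm_num [gaussIntegralTaylor, Finset.sum_range_succ, Nat.factorial]
  calc stdNormalCDF √3 < stdNormalCDF 1.7321 := strictMono_stdNormalCDF hsqrt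
    _ ≤ 1 / 2 + gaussIntegralTaylor 11 1.7321 / √(2 * π) :=
      stdNormalCDF_le_of_odd (by decide) (by norm_num)
    _ ≤ 1 / 2 + 0.4585 := by
      gcongr
      rw [div_le_iff₀ (by positivity)]
      linarith [sqrt_two_pi_mem_Ioo.1]
    _ = 0.9585 := by norm_num

-- `1.6448528` lies just below the quantile `z_{0.95}`, and `1.645083` below `1.00014 * 1.6448528`.
lemma stdNormalCDF_le_level_90 : stdNormalCDF 1.6448528 ≤ 0.95 := by
  have htaylor : gaussIntegralTaylor 15 1.6448528 ≤ 0.45 * 2.5066282746 := by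
    norm_num [gaussIntegralTaylor, Finset.sum_range_succ, Nat.factorial]
  calc stdNormalCDF 1.6448528 ≤ 1 / 2 + gaussIntegralTaylor 15 1.6448528 / √(2 * π) :=
      stdNormalCDF_le_of_odd (by decide) (by norm_num)
    _ ≤ 1 / 2 + 0.45 := by
      gcongr
      rw [div_le_iff₀ (by positivity)]
      linarith [sqrt_two_pi_mem_Ioo.1]
    _ = 0.95 := by norm_num

lemma le_stdNormalCDF_level_90 : 0.95002365 ≤ stdNormalCDF 1.645083 := by
  have htaylor : 0.45002365 * 2.5066282747 ≤ gaussIntegralTaylor 14 1.645083 := by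
    norm_num [gaussIntegralTaylor, Finset.sum_range_succ, Nat.factorial]
  calc (0.95002365 : ℝ) = 1 / 2 + 0.45002365 := by norm_num
    _ ≤ 1 / 2 + gaussIntegralTaylor 14 1.645083 / √(2 * π) := by
      gcongr
      rw [le_div_iff₀ (by positivity)]
      linarith [sqrt_two_pi_mem_Ioo.2]
    _ ≤ stdNormalCDF 1.645083 := le_stdNormalCDF_of_even (by decide) (by norm_num)

lemma gaussianPDFReal_le_level_90 : φ 1.645083 ≤ 0.1031 := by
  have htaylor := neg_one_pow_mul_exp_neg_sub_sum_nonneg 11 (x := 1.645083 ^ 2 / 2) (by norm_num)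
  have hexp : exp (-(1.645083 ^ 2 / 2)) ≤ 2.5066282746 * 0.1031 := by
    norm_num [Finset.sum_range_succ, Nat.factorial] at htaylor ⊢
    linarith
  rw [gaussianPDFReal_zero_one, inv_mul_le_iff₀ (by positivity)]
  linarith [hexp, sqrt_two_pi_mem_Ioo.1]

/-! ### The coverage probability as a function of the critical value -/

lemma strictMono_coverageProb {t : ℝ} (ht : 0 < cos t) : StrictMono (coverageProb t) := by
  intro a b hab
  have := inv_pos.2 ht
  unfold coverageProb
  apply sub_lt_sub <;> apply strictMono_stdNormalCDF <;> gcongr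

lemma continuous_coverageProb (t : ℝ) : Continuous (coverageProb t) := by
  have := continuous_stdNormalCDF
  unfold coverageProb
  fun_prop

lemma coverageProb_zero_right (t : ℝ) : coverageProb t 0 = 0 := by
  simp [coverageProb]

lemma tendsto_coverageProb_atTop {t : ℝ} (ht : 0 < cos t) :
    Tendsto (coverageProb t) atTop (𝓝 1) := by
  have hc := inv_pos.2 ht
  have hupper : Tendsto (fun z : ℝ => z * (cos t)⁻¹ - tan t) atTop atTop :=
    tendsto_atTop_add_const_right _ _ (tendsto_id.atTop_mul_const hc)
  have hlower : Tendsto (fun z : ℝ => -z * (cos t)⁻¹ - tan t) atTop atBot :=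
    tendsto_atBot_add_const_right _ _ (tendsto_neg_atTop_atBot.atBot_mul_const hc)
  rw [← sub_zero (1 : ℝ)]
  exact (tendsto_stdNormalCDF_atTop.comp hupper).sub (tendsto_stdNormalCDF_atBot.comp hlower)

lemma existsUnique_coverageProb_eq {t p : ℝ} (ht : 0 < cos t) (h0 : 0 ≤ p) (h1 : p < 1) :
    ∃! c, p = coverageProb t c := by
  obtain ⟨c, hc⟩ := mem_range_of_exists_le_of_exists_ge (continuous_coverageProb t)
    ⟨0, (coverageProb_zero_right t).trans_le h0⟩
    ((tendsto_coverageProb_atTop ht).eventually_const_le h1).exists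
  exact ⟨c, hc.symm, fun d hd => (strictMono_coverageProb ht).injective (hd.symm.trans hc.symm)⟩

lemma two_mul_stdNormalCDF_sub_one_le_coverageProb {t z : ℝ} (ht : 0 < cos t) :
    2 * stdNormalCDF ((z - 1) / cos t) - 1 ≤ coverageProb t z := by
  have hupper : (z - 1) / cos t ≤ z * (cos t)⁻¹ - tan t := by
    rw [tan_eq_sin_div_cos, ← div_eq_mul_inv, ← sub_div]
    gcongr
    exact sin_le_one t
  have hlower : -z * (cos t)⁻¹ - tan t ≤ -((z - 1) / cos t) := by
    rw [tan_eq_sin_div_cos, ← div_eq_mul_inv, ← sub_div, ← neg_div]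
    gcongr
    linarith [neg_one_le_sin t]
  have h1 := strictMono_stdNormalCDF.monotone hupper
  have h2 := strictMono_stdNormalCDF.monotone hlower
  rw [stdNormalCDF_neg] at h2
  unfold coverageProb
  linarith

/-! ### The coverage probability as a function of the angle -/

lemma coverageProb_zero_left (z : ℝ) : coverageProb 0 z = 2 * stdNormalCDF z - 1 := by
  simp only [coverageProb, cos_zero, inv_one, mul_one, tan_zero, sub_zero, stdNormalCDF_neg]
  ring

lemma gaussianPDFReal_mul_inv_cos_sub_tan {t : ℝ} (z : ℝ) (ht : cos t ≠ 0) :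
    φ (z * (cos t)⁻¹ - tan t) = φ z * exp (-(sin t ^ 2 * (1 + z ^ 2)) / (2 * cos t ^ 2)) *
      exp (z * sin t / cos t ^ 2) := by
  rw [gaussianPDFReal_zero_one, gaussianPDFReal_zero_one, mul_assoc, mul_assoc, ← exp_add,
    ← exp_add]
  congr 2
  rw [tan_eq_sin_div_cos]
  field_simp
  rw [cos_sq']
  ring

lemma hasDerivAt_coverageProb {t : ℝ} (z : ℝ) (ht : cos t ≠ 0) :
    HasDerivAt (coverageProb · z)
      (2 * φ z * exp (-(sin t ^ 2 * (1 + z ^ 2)) / (2 * cos t ^ 2)) / cos t ^ 2 *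
        (z * sin t * cosh (z * sin t / cos t ^ 2) - sinh (z * sin t / cos t ^ 2))) t := by
  have hd (z : ℝ) : HasDerivAt (fun t => stdNormalCDF (z * (cos t)⁻¹ - tan t))
      (φ (z * (cos t)⁻¹ - tan t) * ((z * sin t - 1) / cos t ^ 2)) t := by
    have hinner : HasDerivAt (fun t => z * (cos t)⁻¹ - tan t) ((z * sin t - 1) / cos t ^ 2) t := by
      refine ((((hasDerivAt_cos t).fun_inv ht).const_mul z).sub (hasDerivAt_tan ht)).congr_deriv ?_
      field_simp
    exact (hasDerivAt_stdNormalCDF _).comp t hinner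
  refine ((hd z).sub (hd (-z))).congr_deriv ?_
  have hsymm : φ (-z) = φ z := by simp only [gaussianPDFReal_zero_one, neg_sq]
  rw [gaussianPDFReal_mul_inv_cos_sub_tan z ht, gaussianPDFReal_mul_inv_cos_sub_tan (-z) ht,
    cosh_eq, sinh_eq, hsymm, neg_sq, neg_mul, neg_div (cos t ^ 2)]
  field_simp
  ring

lemma sinh_sub_mul_cosh {u v : ℝ} (hu : u ∈ Ioo (-1) 1) :
    sinh v - u * cosh v = √(1 - u ^ 2) * sinh (v - artanh u) := by
  have : 0 < √(1 - u ^ 2) := sqrt_pos.2 (by nlinarith [hu.1, hu.2])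
  rw [sinh_sub, sinh_artanh hu, cosh_artanh hu]
  field_simp

lemma sinh_lt_mul_cosh {u v : ℝ} (h0 : -1 < u) (h : u < 1 → v < artanh u) :
    sinh v < u * cosh v := by
  rcases lt_or_ge u 1 with h1 | h1
  · rw [← sub_neg, sinh_sub_mul_cosh ⟨h0, h1⟩]
    exact mul_neg_of_pos_of_neg (sqrt_pos.2 (by nlinarith)) (sinh_neg_iff.2 (sub_neg.2 (h h1)))
  · exact (sinh_lt_cosh v).trans_le (le_mul_of_one_le_left (cosh_pos v).le h1)

lemma strictMonoOn_coverageProb {z a : ℝ} (hz : 0 < z) (ha : 0 ≤ a)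
    (h : ∀ t ∈ Ioo a (π / 2), z * sin t < 1 → z * sin t / cos t ^ 2 < artanh (z * sin t)) :
    StrictMonoOn (coverageProb · z) (Ico a (π / 2)) := by
  have hd (t : ℝ) (ht : t ∈ Ico a (π / 2)) := hasDerivAt_coverageProb z
    (cos_pos_of_mem_Ioo (x := t) ⟨by linarith [ht.1, pi_pos], ht.2⟩).ne'
  refine strictMonoOn_of_hasDerivWithinAt_pos (convex_Ico _ _)
    (fun t ht => (hd t ht).continuousAt.continuousWithinAt)
    (fun t ht => (hd t (interior_subset ht)).hasDerivWithinAt) fun t ht => ?_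
  rw [interior_Ico] at ht
  have hc : 0 < cos t := cos_pos_of_mem_Ioo ⟨by linarith [ht.1, pi_pos], ht.2⟩
  have hs : 0 < sin t := sin_pos_of_pos_of_lt_pi (by linarith [ht.1]) (by linarith [ht.2, pi_pos])
  have hpdf := gaussianPDFReal_zero_one_pos z
  exact mul_pos (by positivity)
    (sub_pos.2 (sinh_lt_mul_cosh (by linarith [mul_pos hz hs]) (h t ht)))

lemma mul_sum_range_le_artanh {u : ℝ} (h0 : 0 ≤ u) (h1 : u < 1) (n : ℕ) :
    u * ∑ k ∈ Finset.range n, (u ^ 2) ^ k / (2 * k + 1) ≤ artanh u := by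
  rw [artanh_eq_half_log ⟨by linarith, h1.le⟩, Finset.mul_sum]
  refine le_trans (le_of_eq (Finset.sum_congr rfl fun k _ => ?_)) (sum_range_le_log_div h0 h1 n)
  rw [← pow_mul]
  ring

lemma div_one_sub_sq_div_three_lt_artanh {u : ℝ} (h0 : 0 < u) (h1 : u < 1) :
    u / (1 - u ^ 2 / 3) < artanh u := by
  have hsq : u ^ 2 < 1 := pow_lt_one₀ h0.le h1 two_ne_zero
  have hden : 0 < 1 - u ^ 2 / 3 := by linarith
  have hseries : (1 - u ^ 2 / 3)⁻¹ < ∑ k ∈ Finset.range 3, (u ^ 2) ^ k / (2 * k + 1) := by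
    have hpos : 0 < u ^ 4 * (1 - u ^ 2 * 3 / 4) := mul_pos (by positivity) (by linarith)
    rw [inv_lt_iff_one_lt_mul₀ hden]
    norm_num [Finset.sum_range_succ]
    linarith
  calc u / (1 - u ^ 2 / 3) = u * (1 - u ^ 2 / 3)⁻¹ := div_eq_mul_inv _ _
    _ < u * ∑ k ∈ Finset.range 3, (u ^ 2) ^ k / (2 * k + 1) := by gcongr
    _ ≤ artanh u := mul_sum_range_le_artanh h0.le h1 3

lemma strictMonoOn_coverageProb_of_three_le_sq {z : ℝ} (hz : 0 < z) (hz3 : 3 ≤ z ^ 2) :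
    StrictMonoOn (coverageProb · z) (Ico 0 (π / 2)) := by
  refine strictMonoOn_coverageProb hz le_rfl fun t ht hu => ?_
  have hs : 0 < sin t := sin_pos_of_pos_of_lt_pi ht.1 (by linarith [ht.2, pi_pos])
  have hu0 : 0 < z * sin t := mul_pos hz hs
  have hsin : sin t ^ 2 ≤ (z * sin t) ^ 2 / 3 := by
    rw [mul_pow]
    nlinarith [sq_nonneg (sin t)]
  have hden : 0 < 1 - (z * sin t) ^ 2 / 3 := by nlinarith
  calc z * sin t / cos t ^ 2 = z * sin t / (1 - sin t ^ 2) := by rw [cos_sq']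
    _ ≤ z * sin t / (1 - (z * sin t) ^ 2 / 3) := by gcongr
    _ < artanh (z * sin t) := div_one_sub_sq_div_three_lt_artanh hu0 hu

/-! ### The loss of coverage near the level 90% -/

/-- The polynomial `q` of the estimate `u / (1 - y) - artanh u ≤ u * y * q y / (1 - y)`, where
`y = sin t ^ 2` and `u = z * sin t`. Its coefficients come from seven terms of the power series of
`artanh u / u` at the critical value `z ^ 2 = 2.7062`. -/
def driftPoly (y : ℝ) : ℝ :=
  0.09794 - 0.5626 * y - 1.366 * y ^ 2 - 3.12 * y ^ 3 - 7.2 * y ^ 4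

lemma continuous_driftPoly : Continuous driftPoly := by
  unfold driftPoly
  fun_prop

lemma strictAntiOn_driftPoly : StrictAntiOn driftPoly (Ici 0) := by
  intro x hx y _ hxy
  have hx' : 0 ≤ x := hx
  unfold driftPoly
  gcongr

lemma le_of_driftPoly_nonneg {y : ℝ} (h0 : 0 ≤ y) (hq : 0 ≤ driftPoly y) : y ≤ 0.125 := by
  by_contra! h
  have := strictAntiOn_driftPoly (show (0.125 : ℝ) ∈ Ici 0 by norm_num) h0 h
  norm_num [driftPoly] at this hq
  linarith

lemma one_sub_mul_driftPoly_le {W y : ℝ} (hW : 2.7062 ≤ W) (h0 : 0 ≤ y) (hWy : W * y < 1) :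
    1 - y * driftPoly y ≤ (1 - y) * ∑ k ∈ Finset.range 7, (W * y) ^ k / (2 * k + 1) := by
  have hy : y < 0.37 := by nlinarith
  have hy1 : 0 ≤ 1 - y := by linarith
  calc 1 - y * driftPoly y
      ≤ (1 - y) * ∑ k ∈ Finset.range 7, (2.7062 * y) ^ k / (2 * k + 1) := by
        have h6 : 0 ≤ y ^ 6 * (0.37 - y) := mul_nonneg (by positivity) (by linarith)
        have h6' : 0 ≤ y ^ 6 := by positivity
        norm_num [driftPoly, Finset.sum_range_succ]
        nlinarith [pow_nonneg h0 2, pow_nonneg h0 3, pow_nonneg h0 4, pow_nonneg h0 5]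
    _ ≤ (1 - y) * ∑ k ∈ Finset.range 7, (W * y) ^ k / (2 * k + 1) := by gcongr

lemma div_sub_artanh_le {z s : ℝ} (hz : 0 < z) (hz2 : 2.7062 ≤ z ^ 2) (hs : 0 ≤ s)
    (hu : z * s < 1) :
    z * s / (1 - s ^ 2) - artanh (z * s) ≤ z * s * (s ^ 2 * driftPoly (s ^ 2) / (1 - s ^ 2)) := by
  have hu0 : 0 ≤ z * s := mul_nonneg hz.le hs
  have hWy : z ^ 2 * s ^ 2 < 1 := by
    rw [← mul_pow]
    exact pow_lt_one₀ hu0 hu two_ne_zero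
  have hden : 0 < 1 - s ^ 2 := by nlinarith [sq_nonneg s]
  have hsum := one_sub_mul_driftPoly_le hz2 (sq_nonneg s) hWy
  rw [← div_le_iff₀' hden, ← mul_pow] at hsum
  have hartanh := (mul_le_mul_of_nonneg_left hsum hu0).trans (mul_sum_range_le_artanh hu0 hu 7)
  calc z * s / (1 - s ^ 2) - artanh (z * s)
      ≤ z * s / (1 - s ^ 2) - z * s * ((1 - s ^ 2 * driftPoly (s ^ 2)) / (1 - s ^ 2)) := by gcongr
    _ = z * s * (s ^ 2 * driftPoly (s ^ 2) / (1 - s ^ 2)) := by ring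

lemma sinh_le_mul {x : ℝ} (h0 : 0 ≤ x) (h1 : x ≤ 0.01) : sinh x ≤ 1.0001 * x := by
  have hx : |x| ≤ 1 := by
    rw [abs_of_nonneg h0]
    linarith
  have hpos := exp_bound hx (n := 3) (by norm_num)
  have hneg := exp_bound (x := -x) (by rwa [abs_neg]) (n := 3) (by norm_num)
  rw [abs_neg] at hneg
  rw [abs_of_nonneg h0, abs_le] at hpos hneg
  norm_num [Finset.sum_range_succ, Nat.factorial] at hpos hneg
  have hcube : x ^ 3 ≤ 0.0001 * x := by
    calc x ^ 3 = x ^ 2 * x := by ring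
      _ ≤ 0.01 ^ 2 * x := by gcongr
      _ = 0.0001 * x := by norm_num
  rw [sinh_eq]
  linarith [hpos.2, hneg.1]

lemma one_sub_le_exp_neg {x : ℝ} (h0 : 0 ≤ x) (h1 : x < 1) : 1 - x ≤ exp (-x - x ^ 2 / 2) := by
  have hsum := hasSum_pow_div_log_of_abs_lt_one (abs_lt.2 ⟨by linarith, h1⟩)
  have h := sum_le_hasSum (Finset.range 2) (fun k _ => by positivity) hsum
  norm_num [Finset.sum_range_succ] at h
  rw [← log_le_iff_le_exp (by linarith)]
  linarith

lemma inv_le_exp_half_sub {x : ℝ} (h0 : 0 < x) (h1 : x ≤ 1) : x⁻¹ ≤ exp ((x⁻¹ - x) / 2) := by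
  have h := self_le_sinh_iff.2 (log_nonneg ((one_le_inv₀ h0).2 h1))
  rw [sinh_log (inv_pos.2 h0), inv_inv] at h
  rwa [← log_le_iff_le_exp (inv_pos.2 h0)]

lemma exp_neg_quadratic_le {y : ℝ} (h0 : 0 ≤ y) (h1 : y ≤ 0.125) :
    exp (-(0.706 * y + 2.43 * y ^ 2)) ≤ 1 - 0.7 * y - 1.9 * y ^ 2 := by
  have h3 : 0 ≤ y ^ 2 * (0.125 - y) := mul_nonneg (sq_nonneg y) (by linarith)
  have h4 : 0 ≤ y ^ 3 * (0.125 - y) := mul_nonneg (pow_nonneg h0 3) (by linarith)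
  refine (exp_neg_le_quadratic (by positivity)).trans ?_
  linarith [sq_nonneg y]

lemma one_sub_mul_mul_exp_neg_le {W y : ℝ} (hW : 2.7062 ≤ W) (h0 : 0 ≤ y) (h1 : y ≤ 0.125)
    (hWy : W * y < 1) :
    (1 - W * y) * exp (-(y * (1 + W) / (1 - y))) ≤
      (1 - y) ^ 5 * (1 - 0.7 * y - 1.9 * y ^ 2) ^ 2 := by
  have hy : 0 < 1 - y := by linarith
  set r : ℝ := 0.706 * y + 2.43 * y ^ 2 with hr
  have hexponent : -(W * y) - (W * y) ^ 2 / 2 + -(y * (1 + W) / (1 - y)) +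
      5 * (((1 - y)⁻¹ - (1 - y)) / 2) ≤ 2 * -r := by
    have hdiv : y + y ^ 2 ≤ y / (1 - y) := by
      rw [le_div_iff₀ hy]
      nlinarith [pow_nonneg h0 3]
    calc _ = 2.5 * y - W * y - W ^ 2 * y ^ 2 / 2 - (W - 1.5) * (y / (1 - y)) := by
          field_simp
          ring
      _ ≤ 2.5 * y - 2.7062 * y - 2.7062 ^ 2 * y ^ 2 / 2 - (2.7062 - 1.5) * (y + y ^ 2) := by
          gcongr
          linarith
      _ ≤ 2 * -r := by
          rw [hr]
          linarith [sq_nonneg y]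
  have hexp : (1 - W * y) * exp (-(y * (1 + W) / (1 - y))) * (1 - y)⁻¹ ^ 5 ≤ exp (-r) ^ 2 := by
    calc _ ≤ exp (-(W * y) - (W * y) ^ 2 / 2) * exp (-(y * (1 + W) / (1 - y))) *
          exp (((1 - y)⁻¹ - (1 - y)) / 2) ^ 5 := by
          gcongr
          · exact one_sub_le_exp_neg (mul_nonneg (by linarith) h0) hWy
          · exact inv_le_exp_half_sub hy (by linarith)
      _ = exp (-(W * y) - (W * y) ^ 2 / 2 + -(y * (1 + W) / (1 - y)) +
          5 * (((1 - y)⁻¹ - (1 - y)) / 2)) := by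
          rw [exp_add, exp_add, ← exp_nat_mul]
          norm_num
      _ ≤ exp (2 * -r) := exp_le_exp.2 hexponent
      _ = exp (-r) ^ 2 := by rw [← exp_nat_mul]; norm_num
  rw [inv_pow, ← div_eq_mul_inv, div_le_iff₀' (by positivity)] at hexp
  exact hexp.trans (by gcongr; exact exp_neg_quadratic_le h0 h1)

lemma sqrt_mul_exp_neg_le {z s c : ℝ} (hz2 : 2.7062 ≤ z ^ 2) (hs : s ^ 2 ≤ 0.125)
    (hu : (z * s) ^ 2 < 1) (hc : 0 < c) (hsc : c ^ 2 = 1 - s ^ 2) :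
    √(1 - (z * s) ^ 2) * exp (-(s ^ 2 * (1 + z ^ 2)) / (2 * c ^ 2)) ≤
      c ^ 5 * (1 - 0.7 * s ^ 2 - 1.9 * (s ^ 2) ^ 2) := by
  have hm : 0 ≤ 1 - 0.7 * s ^ 2 - 1.9 * (s ^ 2) ^ 2 := by nlinarith [sq_nonneg s]
  refine (sq_le_sq₀ (by positivity) (by positivity)).1 ?_
  calc _ = (1 - z ^ 2 * s ^ 2) * exp (-(s ^ 2 * (1 + z ^ 2) / (1 - s ^ 2))) := by
        rw [mul_pow, sq_sqrt (by linarith), ← exp_nat_mul, ← hsc]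
        congr 2 <;> [ring; (push_cast; field_simp)]
    _ ≤ (1 - s ^ 2) ^ 5 * (1 - 0.7 * s ^ 2 - 1.9 * (s ^ 2) ^ 2) ^ 2 :=
      one_sub_mul_mul_exp_neg_le hz2 (sq_nonneg s) hs (by rwa [← mul_pow])
    _ = _ := by
        rw [← hsc]
        ring

lemma driftPoly_mul_le {y : ℝ} (h0 : 0 ≤ y) (hq : 0 ≤ driftPoly y) :
    1.0001 * driftPoly y * (1 - 0.7 * y - 1.9 * y ^ 2) ≤ 0.098 - 0.62 * y - 1.38 * y ^ 2 := by
  have h1 := le_of_driftPoly_nonneg h0 hq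
  have h2 : 0 ≤ y * (0.125 - y) := mul_nonneg h0 (by linarith)
  have h3 : 0 ≤ y * (y - 0.095) ^ 2 := by positivity
  have h4 : 0 ≤ y ^ 4 * (0.125 - y) := mul_nonneg (by positivity) (by linarith)
  have h5 : 0 ≤ y ^ 5 * (0.125 - y) := mul_nonneg (by positivity) (by linarith)
  unfold driftPoly
  linarith [pow_nonneg h0 4]

lemma mul_driftPoly_le {y : ℝ} (h0 : 0 ≤ y) (hq : 0 ≤ driftPoly y) :
    y * driftPoly y ≤ 0.01 * (1 - y) := by
  have h1 := le_of_driftPoly_nonneg h0 hq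
  unfold driftPoly
  linarith [sq_nonneg (y - 0.09), pow_nonneg h0 3, pow_nonneg h0 4, pow_nonneg h0 5]

lemma exp_neg_mul_sinh_sub_le {z s c : ℝ} (hz : 0 < z) (hz2 : 2.7062 ≤ z ^ 2) (hs : 0 ≤ s)
    (hc : 0 < c) (hsc : c ^ 2 = 1 - s ^ 2) (hq : 0 ≤ driftPoly (s ^ 2)) :
    exp (-(s ^ 2 * (1 + z ^ 2)) / (2 * c ^ 2)) *
        (sinh (z * s / c ^ 2) - z * s * cosh (z * s / c ^ 2)) ≤
      z * s * c ^ 3 * (s ^ 2 * (0.098 - 0.62 * s ^ 2 - 1.38 * (s ^ 2) ^ 2)) := by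
  have hu0 : 0 ≤ z * s := mul_nonneg hz.le hs
  have hs1 := le_of_driftPoly_nonneg (sq_nonneg s) hq
  have hm : 0 ≤ 1 - 0.7 * s ^ 2 - 1.9 * (s ^ 2) ^ 2 := by nlinarith [sq_nonneg s]
  have hrate := driftPoly_mul_le (sq_nonneg s) hq
  have hrate0 : 0 ≤ 0.098 - 0.62 * s ^ 2 - 1.38 * (s ^ 2) ^ 2 := le_trans (by positivity) hrate
  rcases lt_or_ge (z * s) 1 with hu | hu
  · set D := z * s * (s ^ 2 * driftPoly (s ^ 2) / c ^ 2) with hD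
    have hdrift : z * s / c ^ 2 - artanh (z * s) ≤ D := by
      rw [hD, hsc]
      exact div_sub_artanh_le hz hz2 hs hu
    have hD1 : D ≤ 0.01 := by
      refine (mul_le_of_le_one_left (by positivity) hu.le).trans ?_
      rw [div_le_iff₀ (by positivity), hsc]
      exact mul_driftPoly_le (sq_nonneg s) hq
    calc _ = √(1 - (z * s) ^ 2) * exp (-(s ^ 2 * (1 + z ^ 2)) / (2 * c ^ 2)) *
          sinh (z * s / c ^ 2 - artanh (z * s)) := by
          rw [sinh_sub_mul_cosh ⟨by linarith, hu⟩]
          ring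
      _ ≤ √(1 - (z * s) ^ 2) * exp (-(s ^ 2 * (1 + z ^ 2)) / (2 * c ^ 2)) * (1.0001 * D) := by
          gcongr
          exact (sinh_le_sinh.2 hdrift).trans (sinh_le_mul (by positivity) hD1)
      _ ≤ c ^ 5 * (1 - 0.7 * s ^ 2 - 1.9 * (s ^ 2) ^ 2) * (1.0001 * D) := by
          refine mul_le_mul_of_nonneg_right ?_ (by positivity)
          exact sqrt_mul_exp_neg_le hz2 hs1 (pow_lt_one₀ hu0 hu two_ne_zero) hc hsc
      _ = z * s * c ^ 3 * (s ^ 2 * (1.0001 * driftPoly (s ^ 2) *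
          (1 - 0.7 * s ^ 2 - 1.9 * (s ^ 2) ^ 2))) := by
          rw [hD]
          field_simp
      _ ≤ _ := by gcongr
  · have hneg : sinh (z * s / c ^ 2) - z * s * cosh (z * s / c ^ 2) ≤ 0 :=
      (sub_neg.2 (sinh_lt_mul_cosh (by linarith) fun h => absurd h hu.not_gt)).le
    exact (mul_nonpos_of_nonneg_of_nonpos (exp_pos _).le hneg).trans (by positivity)

/-- A bound for the loss `(coverageProb 0 z - coverageProb t z) / (z * φ z)` of coverage, with
`y = sin t ^ 2`. -/
def lossBound (y : ℝ) : ℝ := 0.049 * y ^ 2 - 0.62 / 3 * y ^ 3 - 0.345 * y ^ 4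

lemma hasDerivAt_lossBound (y : ℝ) :
    HasDerivAt lossBound (y * (0.098 - 0.62 * y - 1.38 * y ^ 2)) y := by
  refine ((((hasDerivAt_pow 2 y).const_mul 0.049).sub ((hasDerivAt_pow 3 y).const_mul
    (0.62 / 3))).sub ((hasDerivAt_pow 4 y).const_mul 0.345)).congr_deriv ?_
  norm_num
  ring

lemma lossBound_le {y : ℝ} (h0 : 0 ≤ y) : lossBound y ≤ 0.0002785 := by
  -- `lossBound` attains its maximum near `y = 0.1225`.
  have h : 0 ≤ (y - 0.1225) ^ 2 * (0.345 * y ^ 2 + 0.2912 * y + 0.0171) := by positivity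
  unfold lossBound
  nlinarith

lemma coverageProb_zero_sub_le {z t : ℝ} (hz : 0 < z) (hz2 : 2.7062 ≤ z ^ 2) (h0 : 0 ≤ t)
    (h1 : t < π / 2) (hq : 0 ≤ driftPoly (sin t ^ 2)) :
    coverageProb 0 z - z * φ z * lossBound (sin t ^ 2) ≤ coverageProb t z := by
  have hcos (x : ℝ) (hx : x ∈ Icc 0 t) : 0 < cos x :=
    cos_pos_of_mem_Ioo ⟨by linarith [hx.1, pi_pos], by linarith [hx.2]⟩
  have hmono := le_of_hasDerivAt_nonneg h0
    (f := fun x => coverageProb x z + z * φ z * lossBound (sin x ^ 2))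
    (fun x hx => (hasDerivAt_coverageProb z (hcos x hx).ne').add
      (((hasDerivAt_lossBound (sin x ^ 2)).comp x ((hasDerivAt_sin x).pow 2)).const_mul _))
    fun x hx => by
      have hc := hcos x hx
      have hs : 0 ≤ sin x := sin_nonneg_of_nonneg_of_le_pi hx.1 (by linarith [hx.2])
      have hst : sin x ≤ sin t := sin_le_sin_of_le_of_le_pi_div_two (by linarith [hx.1]) h1.le hx.2
      have hqx : 0 ≤ driftPoly (sin x ^ 2) :=
        hq.trans (strictAntiOn_driftPoly.antitoneOn (mem_Ici.2 (sq_nonneg _))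
          (mem_Ici.2 (sq_nonneg _)) (by gcongr))
      have hloss := exp_neg_mul_sinh_sub_le hz hz2 hs hc (cos_sq' x) hqx
      have hfactor : 0 ≤ 2 * φ z / cos x ^ 2 :=
        div_nonneg (by linarith [gaussianPDFReal_zero_one_pos z]) (sq_nonneg _)
      refine (mul_nonneg hfactor (sub_nonneg.2 hloss)).trans (le_of_eq ?_)
      field_simp
      ring
  simp only [sin_zero] at hmono
  have hzero : lossBound (0 ^ 2) = 0 := by norm_num [lossBound]
  rw [hzero] at hmono
  linarith

lemma strictMonoOn_sin_sq : StrictMonoOn (fun t => sin t ^ 2) (Icc 0 (π / 2)) := by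
  intro x hx y hy hxy
  have hs : 0 ≤ sin x := sin_nonneg_of_nonneg_of_le_pi hx.1 (by linarith [hx.2, pi_pos])
  exact pow_lt_pow_left₀
    (sin_lt_sin_of_lt_of_le_pi_div_two (by linarith [hx.1, pi_pos]) hy.2 hxy) hs two_ne_zero

lemma strictMonoOn_coverageProb_of_driftPoly_nonpos {z a : ℝ} (hz : 0 < z) (hz2 : 2.7062 ≤ z ^ 2)
    (ha : 0 ≤ a) (hq : driftPoly (sin a ^ 2) ≤ 0) :
    StrictMonoOn (coverageProb · z) (Ico a (π / 2)) := by
  refine strictMonoOn_coverageProb hz ha fun t ht hu => ?_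
  have hs : 0 < sin t := sin_pos_of_pos_of_lt_pi (ha.trans_lt ht.1) (by linarith [ht.2, pi_pos])
  have hc : 0 < cos t := cos_pos_of_mem_Ioo ⟨by linarith [ht.1, pi_pos], ht.2⟩
  have hlt : sin a ^ 2 < sin t ^ 2 := strictMonoOn_sin_sq ⟨ha, by linarith [ht.1, ht.2]⟩
    ⟨ha.trans ht.1.le, ht.2.le⟩ ht.1
  have hqt : driftPoly (sin t ^ 2) < 0 := (strictAntiOn_driftPoly (mem_Ici.2 (sq_nonneg _))
    (mem_Ici.2 (sq_nonneg _)) hlt).trans_le hq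
  have hdrift := div_sub_artanh_le hz hz2 hs.le hu
  rw [← cos_sq'] at hdrift
  refine sub_neg.1 (hdrift.trans_lt (mul_neg_of_pos_of_neg (by positivity) ?_))
  exact div_neg_of_neg_of_pos (mul_neg_of_pos_of_neg (by positivity) hqt) (by positivity)

lemma coverageProb_zero_sub_mul_le {z t : ℝ} (hz : 0 < z) (hz2 : 2.7062 ≤ z ^ 2) (h0 : 0 ≤ t)
    (h1 : t < π / 2) : coverageProb 0 z - z * φ z * 0.0002785 ≤ coverageProb t z := by
  have hpdf := gaussianPDFReal_zero_one_pos z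
  have hsmall (a : ℝ) (ha0 : 0 ≤ a) (ha1 : a < π / 2) (hqa : 0 ≤ driftPoly (sin a ^ 2)) :
      coverageProb 0 z - z * φ z * 0.0002785 ≤ coverageProb a z := by
    refine le_trans ?_ (coverageProb_zero_sub_le hz hz2 ha0 ha1 hqa)
    gcongr
    exact lossBound_le (sq_nonneg _)
  rcases le_or_gt 0 (driftPoly (sin t ^ 2)) with hq | hq
  · exact hsmall t h0 h1 hq
  · have hcont : Continuous fun x => driftPoly (sin x ^ 2) :=
      continuous_driftPoly.comp (continuous_sin.pow 2)
    obtain ⟨a, ⟨ha0, hat⟩, hqa⟩ := intermediate_value_Icc' h0 hcont.continuousOn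
      ⟨hq.le, by norm_num [driftPoly]⟩
    exact (hsmall a ha0 (hat.trans_lt h1) hqa.ge).trans
      ((strictMonoOn_coverageProb_of_driftPoly_nonpos hz hz2 ha0 hqa.le).monotoneOn
        ⟨le_rfl, hat.trans_lt h1⟩ ⟨hat, h1⟩ hat)

lemma le_coverageProb_level_90 {t : ℝ} (h0 : 0 ≤ t) (h1 : t < π / 2) :
    0.9 ≤ coverageProb t 1.645083 := by
  have hcdf := le_stdNormalCDF_level_90
  have hpdf := gaussianPDFReal_le_level_90
  refine le_trans ?_ (coverageProb_zero_sub_mul_le (by norm_num) (by norm_num) h0 h1)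
  rw [coverageProb_zero_left]
  linarith

/-! ### Calibrated critical values -/

lemma arccos_div_mem_Ioo {s₁ s₂ : ℝ} (hs₂ : 0 < s₂) (hs : s₂ < s₁) :
    arccos (s₂ / s₁) ∈ Ioo 0 (π / 2) :=
  ⟨arccos_pos.2 ((div_lt_one (hs₂.trans hs)).2 hs),
    arccos_lt_pi_div_two.2 (div_pos hs₂ (hs₂.trans hs))⟩

lemma cos_arccos_div_pos {s₁ s₂ : ℝ} (hs₂ : 0 < s₂) (hs : s₂ < s₁) :
    0 < cos (arccos (s₂ / s₁)) :=
  cos_pos_of_mem_Ioo ⟨by linarith [(arccos_div_mem_Ioo hs₂ hs).1, pi_pos],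
    (arccos_div_mem_Ioo hs₂ hs).2⟩

lemma stdNormalCDF_stdNormalQuantile_one_sub_half {α : ℝ} (h0 : 0 < α) (h1 : α < 2) :
    stdNormalCDF (stdNormalQuantile (1 - α / 2)) = 1 - α / 2 :=
  stdNormalCDF_stdNormalQuantile (by linarith) (by linarith)

lemma le_stdNormalQuantile_level_90 : 1.6448528 ≤ stdNormalQuantile (1 - 1 / 10 / 2) :=
  (le_stdNormalQuantile_iff (by norm_num) (by norm_num)).2
    (stdNormalCDF_le_level_90.trans (by norm_num))

lemma sqrt_three_le_stdNormalQuantile {α : ℝ} (h0 : 0 < α) (h1 : 917 / 1000 < 1 - α) :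
    √3 ≤ stdNormalQuantile (1 - α / 2) := by
  rw [le_stdNormalQuantile_iff (by linarith) (by linarith)]
  linarith [stdNormalCDF_sqrt_three_lt]

section IsCalibrated

variable {s₁ s₂ α c : ℝ}

lemma IsCalibrated.le_iff (hc : IsCalibrated s₁ s₂ α c) (hs₂ : 0 < s₂) (hs : s₂ < s₁) (z : ℝ) :
    c ≤ z ↔ 1 - α ≤ coverageProb (arccos (s₂ / s₁)) z := by
  rw [← (strictMono_coverageProb (cos_arccos_div_pos hs₂ hs)).le_iff_le, ← hc]

lemma IsCalibrated.lt_iff (hc : IsCalibrated s₁ s₂ α c) (hs₂ : 0 < s₂) (hs : s₂ < s₁) (z : ℝ) :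
    c < z ↔ 1 - α < coverageProb (arccos (s₂ / s₁)) z := by
  rw [← (strictMono_coverageProb (cos_arccos_div_pos hs₂ hs)).lt_iff_lt, ← hc]

lemma IsCalibrated.nonneg (hc : IsCalibrated s₁ s₂ α c) (hs₂ : 0 < s₂) (hs : s₂ < s₁)
    (hα : α ≤ 1) : 0 ≤ c := by
  by_contra! h
  rw [hc.lt_iff hs₂ hs, coverageProb_zero_right] at h
  linarith

lemma IsCalibrated.lt_stdNormalQuantile (hc : IsCalibrated s₁ s₂ α c) (hs₂ : 0 < s₂)
    (hs : s₂ < s₁) (h0 : 0 < α) (h1 : α < 2) (hq : √3 ≤ stdNormalQuantile (1 - α / 2)) :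
    c < stdNormalQuantile (1 - α / 2) := by
  obtain ⟨ht0, ht1⟩ := arccos_div_mem_Ioo hs₂ hs
  have hq0 : 0 < stdNormalQuantile (1 - α / 2) := (by positivity : 0 < √3).trans_le hq
  have hmono := strictMonoOn_coverageProb_of_three_le_sq hq0 ((sqrt_le_left hq0.le).1 hq)
    ⟨le_rfl, by positivity⟩ ⟨ht0.le, ht1⟩ ht0
  simp only [coverageProb_zero_left,
    stdNormalCDF_stdNormalQuantile_one_sub_half h0 h1] at hmono
  rw [hc.lt_iff hs₂ hs]
  linarith

lemma IsCalibrated.le_level_90 (hc : IsCalibrated s₁ s₂ (1 / 10) c) (hs₂ : 0 < s₂)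
    (hs : s₂ < s₁) : c ≤ 1.645083 := by
  obtain ⟨ht0, ht1⟩ := arccos_div_mem_Ioo hs₂ hs
  rw [hc.le_iff hs₂ hs]
  linarith [le_coverageProb_level_90 ht0.le ht1]

lemma IsCalibrated.le_one_add_mul (hc : IsCalibrated s₁ s₂ α c) (hs₂ : 0 < s₂) (hs : s₂ < s₁)
    (h0 : 0 < α) (h1 : α < 2) : c ≤ 1 + stdNormalQuantile (1 - α / 2) * (s₂ / s₁) := by
  have hr : 0 < s₂ / s₁ := div_pos hs₂ (hs₂.trans hs)
  have hcos : cos (arccos (s₂ / s₁)) = s₂ / s₁ :=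
    cos_arccos (by linarith) ((div_lt_one (hs₂.trans hs)).2 hs).le
  rw [hc.le_iff hs₂ hs]
  refine le_trans (le_of_eq ?_)
    (two_mul_stdNormalCDF_sub_one_le_coverageProb (cos_arccos_div_pos hs₂ hs))
  rw [hcos, add_sub_cancel_left, mul_div_cancel_right₀ _ hr.ne',
    stdNormalCDF_stdNormalQuantile_one_sub_half h0 h1]
  ring

lemma IsCalibrated.lt_mul_stdNormalQuantile_of_le (hc : IsCalibrated s₁ s₂ (1 / 10) c)
    (hs₂ : 0 < s₂) (hs : s₂ ≤ 1 / 1000 * s₁) :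
    c < 61 / 100 * stdNormalQuantile (1 - 1 / 10 / 2) := by
  have hs₁ : 0 < s₁ := by linarith
  have hq := le_stdNormalQuantile_level_90
  have hratio : s₂ / s₁ ≤ 1 / 1000 := (div_le_iff₀ hs₁).2 hs
  have hle := hc.le_one_add_mul hs₂ (by linarith) (by norm_num) (by norm_num)
  nlinarith

end IsCalibrated

lemma intervalLength_symmInterval {x c s : ℝ} (hc : 0 ≤ c) (hs : 0 ≤ s) :
    intervalLength (symmInterval x c s) = c * (2 * s) := by
  have hcs := mul_nonneg hc hs
  rw [intervalLength, symmInterval, volume_real_Icc_of_le (by linarith)]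
  ring

lemma intervalLength_CI₅ {s₁ c : ℝ} (hc : 0 ≤ c) (hs₁ : 0 ≤ s₁) (x : ℝ) :
    intervalLength (CI₅ s₁ c x) = c * (2 * s₁) :=
  intervalLength_symmInterval hc hs₁

lemma intervalLength_CI₂ {s₁ α : ℝ} (h0 : 0 < α) (h1 : α ≤ 1) (hs₁ : 0 ≤ s₁) (x : ℝ) :
    intervalLength (CI₂ s₁ α x) = stdNormalQuantile (1 - α / 2) * (2 * s₁) := by
  refine intervalLength_symmInterval ?_ hs₁
  rw [le_stdNormalQuantile_iff (by linarith) (by linarith), stdNormalCDF_zero]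
  linarith

theorem theorem3_general (s₁ s₂ : ℝ) (hs₂ : 0 < s₂) (hs : s₂ < s₁) :
    (∀ α : ℝ, 0 < α → α < 1 → ∃! c : ℝ, IsCalibrated s₁ s₂ α c) ∧
    (∀ α : ℝ, 0 < α → 917 / 1000 < 1 - α → ∀ c : ℝ, IsCalibrated s₁ s₂ α c →
      c < stdNormalQuantile (1 - α / 2) ∧
      ∀ x : ℝ, intervalLength (CI₅ s₁ c x) < intervalLength (CI₂ s₁ α x)) ∧
    (∀ c : ℝ, IsCalibrated s₁ s₂ (1 / 10) c → ∀ x : ℝ,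
      intervalLength (CI₅ s₁ c x) ≤
        (1 + 14 / 100000) * intervalLength (CI₂ s₁ (1 / 10) x)) ∧
    (∃ δ : ℝ, 0 < δ ∧ δ < 1 ∧ ∀ r₁ r₂ : ℝ, 0 < r₂ → r₂ ≤ δ * r₁ →
      ∀ c : ℝ, IsCalibrated r₁ r₂ (1 / 10) c → ∀ x : ℝ,
        intervalLength (CI₅ r₁ c x) < 61 / 100 * intervalLength (CI₂ r₁ (1 / 10) x)) := by
  have hs₁ : 0 < s₁ := hs₂.trans hs
  refine ⟨fun α h0 h1 => existsUnique_coverageProb_eq (cos_arccos_div_pos hs₂ hs)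
    (by linarith) (by linarith), fun α h0 h1 c hc => ?_, fun c hc x => ?_, 1 / 1000, by norm_num,
    by norm_num, fun r₁ r₂ hr₂ hr c hc x => ?_⟩
  · have hlt := hc.lt_stdNormalQuantile hs₂ hs h0 (by linarith)
      (sqrt_three_le_stdNormalQuantile h0 h1)
    refine ⟨hlt, fun x => ?_⟩
    rw [intervalLength_CI₅ (hc.nonneg hs₂ hs (by linarith)) hs₁.le,
      intervalLength_CI₂ h0 (by linarith) hs₁.le]
    gcongr
  · have hle : c ≤ (1 + 14 / 100000) * stdNormalQuantile (1 - 1 / 10 / 2) := by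
      linarith [hc.le_level_90 hs₂ hs, le_stdNormalQuantile_level_90]
    rw [intervalLength_CI₅ (hc.nonneg hs₂ hs (by norm_num)) hs₁.le,
      intervalLength_CI₂ (by norm_num) (by norm_num) hs₁.le, ← mul_assoc (1 + _)]
    gcongr
  · have hr₁ : 0 < r₁ := by linarith
    have hlt := hc.lt_mul_stdNormalQuantile_of_le hr₂ hr
    rw [intervalLength_CI₅ (hc.nonneg hr₂ (by linarith) (by norm_num)) hr₁.le,
      intervalLength_CI₂ (by norm_num) (by norm_num) hr₁.le, ← mul_assoc (61 / 100)]
    gcongr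

end

theorem theorem3 {Ω : Type*} [MeasurableSpace Ω] (P : Measure Ω) [IsProbabilityMeasure P]
    (θ b₂ s₁ s₂ : ℝ) (hs₂ : 0 < s₂) (hs : s₂ < s₁)
    (θhat₁ θhat₂ : Ω → ℝ)
    (hlaw₁ : HasLaw θhat₁ (gaussianReal θ (s₁ ^ 2).toNNReal) P)
    (hlaw₂ : HasLaw θhat₂ (gaussianReal (θ + b₂) (s₂ ^ 2).toNNReal) P)
    (hMSE : b₂ ^ 2 + s₂ ^ 2 ≤ s₁ ^ 2) :
    -- the critical value of `CI₅` is well defined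
    (∀ α : ℝ, 0 < α → α < 1 → ∃! c : ℝ, IsCalibrated s₁ s₂ α c) ∧
    -- confidence levels above 91.7%: `CI₅` is strictly shorter than `CI₂`
    (∀ α : ℝ, 0 < α → 917 / 1000 < 1 - α → ∀ c : ℝ, IsCalibrated s₁ s₂ α c →
      c < stdNormalQuantile (1 - α / 2) ∧
      ∀ ω : Ω, intervalLength (CI₅ s₁ c (θhat₂ ω)) < intervalLength (CI₂ s₁ α (θhat₂ ω))) ∧
    -- confidence level 90%: `CI₅` is at most 0.014% longer than `CI₂`
    (∀ c : ℝ, IsCalibrated s₁ s₂ (1 / 10) c → ∀ ω : Ω,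
      intervalLength (CI₅ s₁ c (θhat₂ ω)) ≤
        (1 + 14 / 100000) * intervalLength (CI₂ s₁ (1 / 10) (θhat₂ ω))) ∧
    -- confidence level 90%: `CI₅` can be significantly shorter than `CI₂`, with less than 61%
    -- of its length whenever the ratio of the standard errors is small enough
    (∃ δ : ℝ, 0 < δ ∧ δ < 1 ∧ ∀ r₁ r₂ : ℝ, 0 < r₂ → r₂ ≤ δ * r₁ →
      ∀ c : ℝ, IsCalibrated r₁ r₂ (1 / 10) c → ∀ x : ℝ,
        intervalLength (CI₅ r₁ c x) < 61 / 100 * intervalLength (CI₂ r₁ (1 / 10) x)) := by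
  obtain ⟨hunique, hshorter, hlevel90, hratio⟩ := theorem3_general s₁ s₂ hs₂ hs
  exact ⟨hunique, fun α h0 h1 c hc => (hshorter α h0 h1 c hc).imp_right fun h ω => h (θhat₂ ω),
    fun c hc ω => hlevel90 c hc (θhat₂ ω), hratio⟩
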